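/- Let $B\neq 0$ be a unital commutative complex Banach algebra that is semiprime (the only ideal $J$ of $B$ such that $xy=0$ for all $x,y\in J$ is $J=\{0\}$), and let $T:B\to B$ be a bounded unital endomorphism, i.e. a bounded linear map preserving products and the identity. A bounded operator on a Banach space $E$ is called quasicompact if the spectral radius of its class in the Calkin algebra $\mathcal L(E)/\mathcal K(E)$ is strictly less than $1$ (if $\dim E<\infty$ this algebra is $0$ and every operator is quasicompact). Spectra of operators are taken in $\mathcal L(E)$. Suppose that $T$ is quasicompact. Then there is an integer $n\ge 1$ such that $$\sigma(T^n)\subseteq\{\lambda\in\mathbb C:|\lambda|<1\}\cup\{1\}.\qquad(*)$$ For every integer $n\ge 1$ satisfying $(*)$, $T^n$ is a quasicompact unital endomorphism of $B$ and there are an integer $m\ge1$ and orthogonal idempotents $e_1,\dots,e_m\in B$ such that the following hold. (i) The eigenspace $\ker(I-T^n)$ is a finite-dimensional unital subalgebra of $B$ isomorphic to the algebra $\mathbb C^m$, and it is spanned by $e_1,\dots,e_m$. (ii) Set $B_i=e_iB$ for $1\le i\le m$. Under a norm equivalent to the norm of $B$ restricted to $B_i$, each $B_i$ is a commutative unital semiprime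 Banach algebra with identity $e_i$ of norm $1$, and $B=\bigoplus_{i=1}^m B_i$. (iii) For each $i$, $T^n$ maps $B_i$ into itself and $R_i:=T^n|_{B_i}$ is a quasicompact unital endomorphism of $B_i$; moreover $\sigma(R_i)\subseteq\{\lambda\in\mathbb C:|\lambda|<1\}\cup\{1\}$, and $1$ is an eigenvalue of $R_i$ of (geometric and algebraic) multiplicity $1$. The operators $T^{kn}|_{B_i}=R_i^k$ converge in operator norm, as $k\to\infty$, to a bounded unital endomorphism $S_i$ of $B_i$ of rank $1$. (iv) The operators $T^{kn}$ converge in operator norm, as $k\to\infty$, to the bounded unital endomorphism $S$ of $B$ given by $$S(b)=\sum_{i=1}^m S_i(be_i)\qquad(b\in B),$$ and $S$ has rank $m$. -/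

import Mathlib

open Filter Topology

/-- A commutative ring is semiprime if `J = 0` is the only ideal such that the product of every
pair of elements of `J` is `0`. -/
def IsSemiprimeAlg (A : Type*) [CommRing A] : Prop :=
  ∀ J : Ideal A, (∀ x ∈ J, ∀ y ∈ J, x * y = 0) → J = ⊥

section Calkin

/-- The compact operators on `E`, as an ideal of the algebra of bounded operators on `E`. -/
def compactIdeal (E : Type*) [NormedAddCommGroup E] [NormedSpace ℂ E] : Ideal (E →L[ℂ] E) where
  carrier := {f | IsCompactOperator f}
  add_mem' hf hg := IsCompactOperator.add hf hg
  zero_mem' := isCompactOperator_zero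
  smul_mem' c _ hf := IsCompactOperator.clm_comp hf c

instance compactIdeal_isTwoSided (E : Type*) [NormedAddCommGroup E] [NormedSpace ℂ E] :
    (compactIdeal E).IsTwoSided where
  mul_mem_of_left b ha := IsCompactOperator.comp_clm ha b

/-- The Calkin algebra: bounded operators modulo compact operators. -/
abbrev CalkinAlgebra (E : Type*) [NormedAddCommGroup E] [NormedSpace ℂ E] : Type _ :=
  (E →L[ℂ] E) ⧸ compactIdeal E

/-- The essential spectral radius of `T`: the spectral radius of the class of `T` in the Calkin
algebra. It is `0` if `E` is finite-dimensional, since then the Calkin algebra is zero. -/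
noncomputable def essentialSpectralRadius {E : Type*} [NormedAddCommGroup E] [NormedSpace ℂ E]
    (T : E →L[ℂ] E) : ENNReal :=
  spectralRadius ℂ (Ideal.Quotient.mk (compactIdeal E) T : CalkinAlgebra E)

/-- A bounded operator is quasicompact if its essential spectral radius is less than `1`. -/
def IsQuasicompact {E : Type*} [NormedAddCommGroup E] [NormedSpace ℂ E] (T : E →L[ℂ] E) : Prop :=
  essentialSpectralRadius T < 1

end Calkin

section Corner

variable {B : Type*} [NormedCommRing B] [NormedAlgebra ℂ B]

/-- The subspace `eB = {e * b | b ∈ B}` of `B`. -/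
noncomputable def cornerSubspace (e : B) : Submodule ℂ B := LinearMap.range (LinearMap.mulLeft ℂ e)

theorem mul_mem_cornerSubspace (e b : B) : e * b ∈ cornerSubspace e := ⟨b, rfl⟩

theorem mul_mem_cornerSubspace_of_mem {e x : B} (hx : x ∈ cornerSubspace e) (y : B) :
    x * y ∈ cornerSubspace e := by
  obtain ⟨b, rfl⟩ := hx
  exact ⟨b * y, by simp [mul_assoc]⟩

theorem idem_mul_of_mem {e x : B} (he : IsIdempotentElem e) (hx : x ∈ cornerSubspace e) :
    e * x = x := by
  obtain ⟨b, rfl⟩ := hx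
  simp [← mul_assoc, he.eq]

/-- For an idempotent `e`, the set `eB` viewed as an algebra with identity `e`, with the addition,
multiplication, scalar multiplication and norm of `B`. -/
def Corner (e : B) (_he : IsIdempotentElem e) : Type _ := cornerSubspace e

namespace Corner

variable {e : B} {he : IsIdempotentElem e}

noncomputable instance : NormedAddCommGroup (Corner e he) :=
  inferInstanceAs (NormedAddCommGroup (cornerSubspace e))

noncomputable instance : NormedSpace ℂ (Corner e he) :=
  inferInstanceAs (NormedSpace ℂ (cornerSubspace e))

/-- The inclusion of `eB` in `B`. -/
def val (x : Corner e he) : B := Subtype.val (p := fun b => b ∈ cornerSubspace e) x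

/-- The element `e * b` of `eB`. -/
noncomputable def mk (e : B) (he : IsIdempotentElem e) (b : B) : Corner e he :=
  (⟨e * b, mul_mem_cornerSubspace e b⟩ : cornerSubspace e)

theorem val_injective : Function.Injective (val : Corner e he → B) := Subtype.val_injective

noncomputable instance : Mul (Corner e he) :=
  ⟨fun x y => (⟨x.val * y.val, mul_mem_cornerSubspace_of_mem x.2 _⟩ : cornerSubspace e)⟩

noncomputable instance : One (Corner e he) := ⟨mk e he 1⟩

theorem val_mul (x y : Corner e he) : (x * y).val = x.val * y.val := rfl

theorem val_add (x y : Corner e he) : (x + y).val = x.val + y.val := rfl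

theorem val_zero : (0 : Corner e he).val = 0 := rfl

theorem val_one : (1 : Corner e he).val = e := mul_one e

theorem val_smul (c : ℂ) (x : Corner e he) : (c • x).val = c • x.val := rfl

theorem norm_def (x : Corner e he) : ‖x‖ = ‖x.val‖ := rfl

theorem idem_mul_val (x : Corner e he) : e * x.val = x.val := idem_mul_of_mem he x.2

noncomputable instance : NormedCommRing (Corner e he) where
  __ := (inferInstance : NormedAddCommGroup (Corner e he))
  mul := (· * ·)
  one := 1
  left_distrib x y z := val_injective (mul_add x.val y.val z.val)
  right_distrib x y z := val_injective (add_mul x.val y.val z.val)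
  zero_mul x := val_injective (zero_mul x.val)
  mul_zero x := val_injective (mul_zero x.val)
  mul_assoc x y z := val_injective (mul_assoc x.val y.val z.val)
  mul_comm x y := val_injective (mul_comm x.val y.val)
  one_mul x := val_injective (by rw [val_mul, val_one, idem_mul_val])
  mul_one x := val_injective (by rw [val_mul, val_one, mul_comm, idem_mul_val])
  norm_mul_le x y := norm_mul_le x.val y.val

noncomputable instance : Algebra ℂ (Corner e he) :=
  Algebra.ofModule (fun c x y => val_injective (smul_mul_assoc c x.val y.val))
    (fun c x y => val_injective (mul_smul_comm c x.val y.val))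

noncomputable instance : NormedAlgebra ℂ (Corner e he) where
  norm_smul_le c x := norm_smul_le c x.val

end Corner

end Corner

/-! Semiprimeness makes `B` reduced: powers of nonzero eigenvectors stay nonzero, and the
finite-dimensional algebra of fixed points is spanned by orthogonal idempotents. Composing a
character with any power of `T` gives a character again, so its values are bounded by a constant
independent of the power. These facts control the spectrum on the unit circle.

Quasicompactness makes `z - T` left invertible modulo compacts for `|z| ≥ 1`. Hence its kernel is
finite-dimensional, and a spectral value of maximal modulus, if that modulus is at least 1, is an
eigenvalue (`exists_eigenvector_of_forall_norm_le`). Powers of an eigenvector exclude `|z| > 1`.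
Characters show that the eigenvalue 1 is semisimple (`IsQuasicompact.apply_eq_of_apply_sub_eq`) and
isolated among unimodular eigenvalues (`IsQuasicompact.exists_unimodular_eigenvalue_isolated`). By
Dirichlet approximation every unimodular eigenvalue is then a root of unity of bounded order, so one
power of `T` sends them all to 1.

For such a power, subtracting a projection onto the fixed points leaves an operator with spectrum in
the open disc, so the iterates converge in norm (`IsQuasicompact.exists_tendsto_pow`). The limit is
an endomorphism with range the fixed algebra; cutting by its minimal idempotents gives the summands.
-/

section Operators

/-! ### Quasicompact operators: peripheral spectrum and convergence of powers -/

variable {E : Type*} [NormedAddCommGroup E] [NormedSpace ℂ E]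

/-- An operator that has a left inverse modulo the compact operators. -/
def HasLeftInverseModCompact (U : E →L[ℂ] E) : Prop :=
  ∃ V : E →L[ℂ] E, IsCompactOperator (V * U - 1 : E →L[ℂ] E)

theorem HasLeftInverseModCompact.add_compact {U K : E →L[ℂ] E} (hU : HasLeftInverseModCompact U)
    (hK : IsCompactOperator K) : HasLeftInverseModCompact (U + K) := by
  obtain ⟨V, hV⟩ := hU
  refine ⟨V, ?_⟩
  have h : V * (U + K) - 1 = (V * U - 1) + V * K := by rw [mul_add]; abel
  rw [h]
  exact hV.add (hK.clm_comp V)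

theorem IsQuasicompact.hasLeftInverseModCompact {T : E →L[ℂ] E} (hT : IsQuasicompact T) {z : ℂ}
    (hz : 1 ≤ ‖z‖) : HasLeftInverseModCompact (algebraMap ℂ (E →L[ℂ] E) z - T) := by
  have h1 : z ∈ resolventSet ℂ
      (Ideal.Quotient.mk (compactIdeal E) T : CalkinAlgebra E) := by
    apply spectrum.mem_resolventSet_of_spectralRadius_lt
    refine lt_of_lt_of_le hT ?_
    exact_mod_cast hz
  obtain ⟨v, hv⟩ := (spectrum.mem_resolventSet_iff.mp h1).exists_left_inv
  obtain ⟨V, rfl⟩ := Ideal.Quotient.mk_surjective v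
  refine ⟨V, ?_⟩
  have h2 : Ideal.Quotient.mk (compactIdeal E) (V * (algebraMap ℂ (E →L[ℂ] E) z - T) - 1) = 0 := by
    rw [map_sub, map_mul, map_sub, map_one, sub_eq_zero]
    exact hv
  exact Ideal.Quotient.eq_zero_iff_mem.mp h2

/-- With `V * U = 1 + K`, the images `K (x n)` have a convergent subsequence while `V (U (x n))`
tends to 0, so `x n` itself converges along it. -/
theorem HasLeftInverseModCompact.exists_tendsto_subseq {U : E →L[ℂ] E}
    (hU : HasLeftInverseModCompact U) {x : ℕ → E} (hx : ∀ n, ‖x n‖ = 1)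
    (hUx : Tendsto (fun n => U (x n)) atTop (𝓝 0)) :
    ∃ (y : E) (φ : ℕ → ℕ), StrictMono φ ∧ Tendsto (x ∘ φ) atTop (𝓝 y) ∧ ‖y‖ = 1 ∧ U y = 0 := by
  obtain ⟨V, hV⟩ := hU
  set K : E →L[ℂ] E := V * U - 1 with hK
  obtain ⟨C, hC, hsub⟩ := IsCompactOperator.image_closedBall_subset_compact
    (f := (K : E →ₗ[ℂ] E)) hV 1
  have hmem : ∀ n, K (x n) ∈ C := fun n =>
    hsub ⟨x n, by simp [hx n], rfl⟩
  obtain ⟨y, -, φ, hφ, hy⟩ := hC.tendsto_subseq hmem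
  have h1 : Tendsto (fun n => V (U (x (φ n)))) atTop (𝓝 0) := by
    have := (V.continuous.tendsto 0).comp (hUx.comp hφ.tendsto_atTop)
    simpa [Function.comp_def] using this
  have h2 : Tendsto (x ∘ φ) atTop (𝓝 (-y)) := by
    have := h1.sub hy
    rw [zero_sub] at this
    refine this.congr fun n => ?_
    simp [hK]
  refine ⟨-y, φ, hφ, h2, ?_, ?_⟩
  · have := h2.norm
    simp only [Function.comp_apply, hx] at this
    exact (tendsto_nhds_unique this tendsto_const_nhds)
  · have h3 := (U.continuous.tendsto (-y)).comp h2
    exact tendsto_nhds_unique h3 (hUx.comp hφ.tendsto_atTop)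

theorem HasLeftInverseModCompact.exists_bound {U : E →L[ℂ] E} (hU : HasLeftInverseModCompact U)
    (hinj : ∀ x, U x = 0 → x = 0) : ∃ c : ℝ, 0 < c ∧ ∀ x, c * ‖x‖ ≤ ‖U x‖ := by
  by_contra! hcon
  have h : ∀ n : ℕ, ∃ x : E, ‖x‖ = 1 ∧ ‖U x‖ < 1 / ((n : ℝ) + 1) := by
    intro n
    obtain ⟨x, hx⟩ := hcon (1 / ((n : ℝ) + 1)) (by positivity)
    have hx0 : 0 < ‖x‖ := by
      by_contra hle
      have : ‖x‖ = 0 := le_antisymm (not_lt.mp hle) (norm_nonneg _)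
      rw [this, mul_zero] at hx
      exact absurd hx (not_lt.mpr (norm_nonneg _))
    refine ⟨((‖x‖⁻¹ : ℝ) : ℂ) • x, ?_, ?_⟩
    · rw [norm_smul, Complex.norm_real, norm_inv, norm_norm, inv_mul_cancel₀ hx0.ne']
    · rw [map_smul, norm_smul, Complex.norm_real, norm_inv, norm_norm, inv_mul_lt_iff₀ hx0, mul_comm]
      exact hx
  choose x hx hUx using h
  have ht : Tendsto (fun n => U (x n)) atTop (𝓝 0) :=
    squeeze_zero_norm (fun n => (hUx n).le) tendsto_one_div_add_atTop_nhds_zero_nat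
  obtain ⟨y, -, -, -, hy1, hy0⟩ := hU.exists_tendsto_subseq hx ht
  rw [hinj y hy0, norm_zero] at hy1
  exact zero_ne_one hy1

/-- On the kernel the compact operator `1 - V * U` is the identity, and Riesz's theorem applies. -/
theorem HasLeftInverseModCompact.finiteDimensional_ker {U : E →L[ℂ] E}
    (hU : HasLeftInverseModCompact U) {F : Submodule ℂ E} (hF : ∀ x, x ∈ F ↔ U x = 0) :
    FiniteDimensional ℂ F := by
  obtain ⟨V, hV⟩ := hU
  have hcl : IsClosed (F : Set E) := by
    have : (F : Set E) = U ⁻¹' {0} := by ext x; simp [hF]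
    rw [this]
    exact isClosed_singleton.preimage U.continuous
  have h1 : IsCompactOperator (-(V * U - 1) : E →L[ℂ] E) := hV.neg
  have hVF : ∀ x : F, ((-(V * U - 1) : E →L[ℂ] E) : E →ₗ[ℂ] E) x = x := by
    intro x
    simp [(hF x).mp x.2]
  have h2 := IsCompactOperator.restrict (f := ((-(V * U - 1) : E →L[ℂ] E) : E →ₗ[ℂ] E)) h1
    (V := F) (fun x hx => by rw [hVF ⟨x, hx⟩]; exact hx) hcl
  apply FiniteDimensional.of_isCompactOperator_id (𝕜 := ℂ)
  refine (congrArg IsCompactOperator (funext fun x => Subtype.ext ?_)).mp h2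
  exact hVF x

theorem IsQuasicompact.pow {T : E →L[ℂ] E} (hT : IsQuasicompact T) {n : ℕ} (hn : 0 < n) :
    IsQuasicompact (T ^ n) := by
  unfold IsQuasicompact essentialSpectralRadius at *
  rw [map_pow, spectralRadius, spectrum.map_pow_of_pos _ hn]
  refine lt_of_le_of_lt ?_ (pow_lt_one₀ zero_le hT hn.ne')
  refine iSup₂_le ?_
  rintro _ ⟨z, hz, rfl⟩
  simp only [nnnorm_pow, ENNReal.coe_pow]
  exact pow_le_pow_left₀ zero_le (le_iSup₂ (α := ENNReal) z hz) n

variable [CompleteSpace E]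

/-- Invertible operators close to `U` inherit a lower bound, so their inverses are uniformly bounded
and a Neumann series reaches `U`. This takes the place of Fredholm index theory. -/
theorem isUnit_of_mem_closure_of_bound {U : E →L[ℂ] E} {c : ℝ} (hc : 0 < c)
    (hU : ∀ x, c * ‖x‖ ≤ ‖U x‖)
    (hcl : ∀ ε > 0, ∃ W : E →L[ℂ] E, IsUnit W ∧ ‖W - U‖ < ε) : IsUnit U := by
  -- Within `c / 4` of `U`, `W` is bounded below by `c / 2`, and `‖W⁻¹‖ ‖W - U‖ ≤ (2 / c) (c / 4) =
  -- 1 / 2`.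
  obtain ⟨W, ⟨w, rfl⟩, hW⟩ := hcl (c / 4) (by positivity)
  have h1 : ∀ x, c / 2 * ‖x‖ ≤ ‖(w : E →L[ℂ] E) x‖ := by
    intro x
    have h2 := (w - U : E →L[ℂ] E).le_opNorm x
    have h3 : ‖U x‖ ≤ ‖(w : E →L[ℂ] E) x‖ + ‖(w - U : E →L[ℂ] E) x‖ := by
      have := norm_sub_le ((w : E →L[ℂ] E) x) ((w - U : E →L[ℂ] E) x)
      simpa using this
    nlinarith [hU x, norm_nonneg x]
  have h2 : ‖(↑w⁻¹ : E →L[ℂ] E)‖ ≤ 2 / c := by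
    refine ContinuousLinearMap.opNorm_le_bound _ (by positivity) fun y => ?_
    have h3 := h1 ((↑w⁻¹ : E →L[ℂ] E) y)
    have h4 : (w : E →L[ℂ] E) ((↑w⁻¹ : E →L[ℂ] E) y) = y := by
      rw [← mul_apply_eq_comp, Units.mul_inv, one_apply_eq_self]
    rw [h4] at h3
    rw [div_mul_eq_mul_div, le_div_iff₀ hc]
    linarith
  have h3 : ‖(↑w⁻¹ : E →L[ℂ] E) * (w - U)‖ < 1 := by
    calc _ ≤ ‖(↑w⁻¹ : E →L[ℂ] E)‖ * ‖(w - U : E →L[ℂ] E)‖ := norm_mul_le _ _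
      _ ≤ 2 / c * (c / 4) := by gcongr
      _ < 1 := by field_simp; norm_num
  have h4 : U = w * (1 - (↑w⁻¹ : E →L[ℂ] E) * (w - U)) := by
    rw [mul_sub, ← mul_assoc, Units.mul_inv]; simp
  rw [h4]
  exact w.isUnit.mul (isUnit_one_sub_of_norm_lt_one h3)

/-- The points `(1 + t) z` lie in the resolvent set, so `z - A` is a limit of invertibles. If it
were injective it would be bounded below, hence invertible. -/
theorem exists_eigenvector_of_forall_norm_le {A : E →L[ℂ] E} {z : ℂ} (hz0 : z ≠ 0)
    (hz : z ∈ spectrum ℂ A) (hmax : ∀ w ∈ spectrum ℂ A, ‖w‖ ≤ ‖z‖)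
    (hA : HasLeftInverseModCompact (algebraMap ℂ (E →L[ℂ] E) z - A)) :
    ∃ x, x ≠ 0 ∧ A x = z • x := by
  by_contra! hcon
  have hinj : ∀ x, (algebraMap ℂ (E →L[ℂ] E) z - A) x = 0 → x = 0 := by
    intro x hx
    by_contra hx0
    refine hcon x hx0 ?_
    rw [sub_apply, sub_eq_zero, ContinuousLinearMap.algebraMap_apply] at hx
    exact hx.symm
  obtain ⟨c, hc, hb⟩ := hA.exists_bound hinj
  refine hz (isUnit_of_mem_closure_of_bound hc hb fun ε hε => ?_)
  have hzn : 0 < ‖z‖ := norm_pos_iff.mpr hz0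
  -- Chosen so that `t ‖z‖ (‖1‖ + 1) = ε / 2`; the `+ 1` keeps the denominator positive whatever
  -- `‖1‖` is.
  set t : ℝ := ε / (2 * ‖z‖ * (‖(1 : E →L[ℂ] E)‖ + 1)) with ht
  have hN : 0 < ‖(1 : E →L[ℂ] E)‖ + 1 := by positivity
  have ht0 : 0 < t := by positivity
  refine ⟨algebraMap ℂ (E →L[ℂ] E) ((1 + t : ℝ) * z) - A, ?_, ?_⟩
  · apply spectrum.notMem_iff.mp
    intro hmem
    have := hmax _ hmem
    rw [norm_mul, Complex.norm_real, Real.norm_of_nonneg (by positivity)] at this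
    nlinarith
  · have : algebraMap ℂ (E →L[ℂ] E) ((1 + t : ℝ) * z) - A - (algebraMap ℂ (E →L[ℂ] E) z - A)
        = ((t : ℂ) * z) • (1 : E →L[ℂ] E) := by
      rw [sub_sub_sub_cancel_right, ← map_sub, Algebra.algebraMap_eq_smul_one]
      congr 1
      push_cast
      ring
    rw [this, norm_smul, norm_mul, Complex.norm_real, Real.norm_of_nonneg ht0.le]
    have h5 : t * ‖z‖ * (‖(1 : E →L[ℂ] E)‖ + 1) = ε / 2 := by
      rw [ht]; field_simp
    nlinarith [mul_pos ht0 hzn]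

theorem exists_eigenvector_forall_norm_le_of_mem_spectrum {A : E →L[ℂ] E} {r : ℝ} (hr : 0 < r)
    (hA : ∀ z : ℂ, r ≤ ‖z‖ → HasLeftInverseModCompact (algebraMap ℂ (E →L[ℂ] E) z - A))
    {z : ℂ} (hz : z ∈ spectrum ℂ A) (hzr : r ≤ ‖z‖) :
    ∃ w : ℂ, ‖z‖ ≤ ‖w‖ ∧ ∃ x, x ≠ 0 ∧ A x = w • x := by
  obtain ⟨w, hw, hmax⟩ := (spectrum.isCompact (𝕜 := ℂ) A).exists_isMaxOn ⟨z, hz⟩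
    continuous_norm.continuousOn
  have hzw : ‖z‖ ≤ ‖w‖ := hmax hz
  refine ⟨w, hzw, exists_eigenvector_of_forall_norm_le ?_ hw (fun v hv => hmax hv)
    (hA w (hzr.trans hzw))⟩
  exact norm_pos_iff.mp (hr.trans_le (hzr.trans hzw))

theorem summable_norm_pow_of_spectrum_subset_ball {A : E →L[ℂ] E}
    (hA : spectrum ℂ A ⊆ Metric.ball (0 : ℂ) 1) : Summable fun k : ℕ => ‖A ^ k‖ := by
  have hr : spectralRadius ℂ A < 1 := by
    rcases (spectrum ℂ A).eq_empty_or_nonempty with h | h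
    · simp [spectralRadius, h]
    · have := spectrum.spectralRadius_lt_of_forall_lt_of_nonempty (𝕜 := ℂ) h (r := 1)
        (fun z hz => by
          have := hA hz
          rw [mem_ball_zero_iff] at this
          exact_mod_cast this)
      exact_mod_cast this
  obtain ⟨ρ, hρ1, hρ2⟩ := ENNReal.lt_iff_exists_nnreal_btwn.mp hr
  have hρ2' : ρ < 1 := by exact_mod_cast hρ2
  have h := (spectrum.pow_nnnorm_pow_one_div_tendsto_nhds_spectralRadius A).eventually_lt_const hρ1
  refine Summable.of_norm_bounded_eventually_nat (g := fun k => (ρ : ℝ) ^ k)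
    (summable_geometric_of_lt_one ρ.2 (by exact_mod_cast hρ2')) ?_
  filter_upwards [h, eventually_gt_atTop 0] with k hk hk0
  have hk' : (0 : ℝ) < k := by exact_mod_cast hk0
  have h2 : (‖A ^ k‖₊ : ENNReal) ≤ (ρ : ENNReal) ^ k := by
    have := ENNReal.rpow_le_rpow hk.le hk'.le
    rwa [← ENNReal.rpow_mul, one_div, inv_mul_cancel₀ hk'.ne', ENNReal.rpow_one,
      ENNReal.rpow_natCast] at this
  rw [norm_norm]
  exact_mod_cast h2

/-- The hypothesis `hker` excludes Jordan blocks at 1. The projection `Q` onto the fixed space is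
arbitrary and need not commute with `S`; only `S * Q = Q` is used to expand the powers. -/
theorem IsQuasicompact.exists_tendsto_pow {S : E →L[ℂ] E} (hS : IsQuasicompact S)
    (hσ : spectrum ℂ S ⊆ Metric.ball (0 : ℂ) 1 ∪ {1})
    (hker : ∀ x, S (S x - x) = S x - x → S x = x) :
    ∃ P : E →L[ℂ] E, Tendsto (fun k : ℕ => S ^ k) atTop (𝓝 P) := by
  set F : Submodule ℂ E := LinearMap.ker ((1 - S : E →L[ℂ] E) : E →ₗ[ℂ] E) with hFdef
  have hF : ∀ x, x ∈ F ↔ S x = x := by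
    intro x
    rw [hFdef, LinearMap.mem_ker, ContinuousLinearMap.coe_coe, sub_apply, sub_eq_zero,
      one_apply_eq_self, eq_comm]
  have hleft : HasLeftInverseModCompact (1 - S) := by
    simpa using hS.hasLeftInverseModCompact (z := 1) (by simp)
  have : FiniteDimensional ℂ F := hleft.finiteDimensional_ker (fun x => by simp [hFdef])
  obtain ⟨q, hq⟩ := Submodule.ClosedComplemented.of_finiteDimensional (𝕜 := ℂ) F
  set Q : E →L[ℂ] E := F.subtypeL.comp q with hQ
  have hQF : ∀ x, S (Q x) = Q x := fun x => (hF _).mp (q x).2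
  have hQid : ∀ x, S x = x → Q x = x := by
    intro x hx
    have := hq ⟨x, (hF x).mpr hx⟩
    simp [hQ, this]
  have hQc : IsCompactOperator Q := by
    have : ProperSpace F := FiniteDimensional.proper ℂ F
    have hq : IsCompactOperator q := isCompactOperator_of_locallyCompactSpace_dom q
    exact hq.clm_comp F.subtypeL
  have hAσ : spectrum ℂ (S - Q) ⊆ Metric.ball (0 : ℂ) 1 := by
    intro z hz
    rw [mem_ball_zero_iff]
    by_contra! hz1
    obtain ⟨w, hw, x, hx0, hx⟩ := exists_eigenvector_forall_norm_le_of_mem_spectrum one_pos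
      (fun v hv => by
        have := (hS.hasLeftInverseModCompact hv).add_compact hQc
        rwa [sub_add] at this) hz hz1
    replace hw := hz1.trans hw
    rw [sub_apply, sub_eq_iff_eq_add] at hx
    by_cases hw1 : w = 1
    · subst hw1
      rw [one_smul] at hx
      have h1 : S x - x = Q x := by rw [hx]; abel
      have h2 : S x = x := hker x (by rw [h1, hQF])
      have h3 : Q x = 0 := by rw [← h1, h2, sub_self]
      exact hx0 ((hQid x h2).symm.trans h3)
    · have hw1' : w - 1 ≠ 0 := sub_ne_zero.mpr hw1
      -- On the span of `x` and `Q x`, `S` is triangular with diagonal `w`, `1`; this correction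
      -- turns `x` into an eigenvector of `S` for `w`, unless it vanishes.
      set y := x + (w - 1)⁻¹ • Q x with hy
      have hSy : S y = w • y := by
        rw [hy, map_add, map_smul, hQF, hx, smul_add, smul_smul, add_assoc, ← one_smul ℂ (Q x),
          smul_smul, ← add_smul, one_smul, mul_one]
        congr 2
        field_simp
        ring
      have hy0 : y = 0 := by
        by_contra hne
        have hwσ : w ∈ spectrum ℂ S := by
          intro hu
          obtain ⟨v, hv⟩ := hu.exists_left_inv
          apply hne
          have := congrArg (fun f : E →L[ℂ] E => f y) hv
          simp [hSy] at this
          exact this.symm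
        rcases hσ hwσ with h | h
        · rw [mem_ball_zero_iff] at h
          linarith
        · exact hw1 h
      have hxF : S x = x := by
        have h1 : x = -((w - 1)⁻¹ • Q x) := eq_neg_of_add_eq_zero_left hy0
        rw [h1, map_neg, map_smul, hQF]
      have h2 : (0 : E) = w • x := by
        have := hx
        rw [hxF, hQid x hxF] at this
        exact (right_eq_add.mp this).symm
      rcases smul_eq_zero.mp h2.symm with h | h
      · simp [h] at hw
        linarith
      · exact hx0 h
  have hsum := summable_norm_pow_of_spectrum_subset_ball hAσ
  -- A geometric sum in `S - Q`, so convergence follows from summability of the powers of `S - Q`.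
  have hpow : ∀ k : ℕ, S ^ k = (S - Q) ^ k + Q * ∑ j ∈ Finset.range k, (S - Q) ^ j := by
    have hSQ : S * Q = Q := ContinuousLinearMap.ext hQF
    intro k
    induction k with
    | zero => simp
    | succ k ih =>
      rw [pow_succ' S, ih, mul_add, ← mul_assoc, hSQ, Finset.sum_range_succ, mul_add,
        pow_succ' (S - Q), sub_mul]
      abel
  refine ⟨0 + Q * ∑' j, (S - Q) ^ j, ?_⟩
  have h := (hsum.of_norm.tendsto_atTop_zero).add
    (tendsto_const_nhds (x := Q) |>.mul hsum.of_norm.hasSum.tendsto_sum_nat)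
  exact h.congr fun k => (hpow k).symm

end Operators

/-! ### Reduced algebras and orthogonal idempotents -/

theorem IsSemiprimeAlg.isReduced {A : Type*} [CommRing A] (hA : IsSemiprimeAlg A) :
    IsReduced A := by
  refine (isReduced_iff_pow_one_lt 2 one_lt_two).mpr ?_
  intro x hx
  have h := hA (Ideal.span {x}) (by
    intro a ha b hb
    obtain ⟨c, rfl⟩ := Ideal.mem_span_singleton'.mp ha
    obtain ⟨d, rfl⟩ := Ideal.mem_span_singleton'.mp hb
    calc c * x * (d * x) = c * d * x ^ 2 := by ring
      _ = 0 := by rw [hx, mul_zero])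
  exact Ideal.span_singleton_eq_bot.mp h

theorem isSemiprimeAlg_of_isReduced (A : Type*) [CommRing A] [IsReduced A] :
    IsSemiprimeAlg A := by
  intro J hJ
  refine (Submodule.eq_bot_iff J).mpr fun x hx => ?_
  exact IsReduced.eq_zero x ⟨2, by rw [pow_two, hJ x hx x hx]⟩

/-- A finite-dimensional reduced commutative algebra over an algebraically closed field is a
finite power of the field. -/
theorem exists_algEquiv_fin_pi (F : Type*) {k : Type*} [Field k] [IsAlgClosed k] [CommRing F]
    [Algebra k F] [FiniteDimensional k F] [IsReduced F] :
    ∃ m : ℕ, Nonempty (F ≃ₐ[k] (Fin m → k)) := by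
  have : IsArtinianRing F := IsArtinianRing.of_finite k F
  have : Finite (MaximalSpectrum F) := inferInstance
  obtain ⟨m, ⟨σ⟩⟩ := Finite.exists_equiv_fin (MaximalSpectrum F)
  have h : ∀ I : MaximalSpectrum F, Nonempty ((F ⧸ I.asIdeal) ≃ₐ[k] k) := fun I => by
    have := I.isMaximal
    let := Ideal.Quotient.field I.asIdeal
    exact ⟨(AlgEquiv.ofBijective (Algebra.ofId k (F ⧸ I.asIdeal))
      (IsAlgClosed.algebraMap_bijective_of_isIntegral)).symm⟩
  let g := fun I => (h I).some
  exact ⟨m, ⟨((IsArtinianRing.equivPi F).restrictScalars k).trans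
    ((AlgEquiv.piCongrRight g).trans (AlgEquiv.piCongrLeft k (fun _ => k) σ))⟩⟩

/-- A finite-dimensional subalgebra of a reduced commutative algebra over an algebraically closed
field is spanned by a complete family of nonzero orthogonal idempotents. -/
theorem Subalgebra.exists_orthogonalIdempotents {k B : Type*} [Field k] [IsAlgClosed k]
    [CommRing B] [Algebra k B] [IsReduced B] (F : Subalgebra k B) [FiniteDimensional k F] :
    ∃ (m : ℕ) (e : Fin m → B), CompleteOrthogonalIdempotents e ∧ (∀ i, e i ≠ 0) ∧
      (∀ i, e i ∈ F) ∧ (∀ x ∈ F, ∃ c : Fin m → k, x = ∑ i, c i • e i) ∧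
      Nonempty (F ≃ₐ[k] (Fin m → k)) := by
  have : IsReduced F := isReduced_of_injective F.val Subtype.val_injective
  obtain ⟨m, ⟨φ⟩⟩ := exists_algEquiv_fin_pi F (k := k)
  have hs : CompleteOrthogonalIdempotents (fun i : Fin m => (Pi.single i 1 : Fin m → k)) :=
    CompleteOrthogonalIdempotents.single (fun _ : Fin m => k)
  let ψ : (Fin m → k) →ₐ[k] B := F.val.comp φ.symm.toAlgHom
  have hψ : Function.Injective ψ := Subtype.val_injective.comp φ.symm.injective
  refine ⟨m, fun i => ψ (Pi.single i 1), ?_, ?_, ?_, ?_, ⟨φ⟩⟩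
  · exact hs.map ψ.toRingHom
  · intro i h
    have := hψ (h.trans (map_zero ψ).symm)
    simpa using congrFun this i
  · intro i
    exact (φ.symm (Pi.single i 1)).2
  · intro x hx
    refine ⟨φ ⟨x, hx⟩, ?_⟩
    have h1 : x = ψ (φ ⟨x, hx⟩) := by simp [ψ]
    conv_lhs => rw [h1, ← Finset.univ_sum_single (φ ⟨x, hx⟩), map_sum]
    refine Finset.sum_congr rfl fun i _ => ?_
    rw [← map_smul, ← Pi.single_smul, smul_eq_mul, mul_one]

theorem CompleteOrthogonalIdempotents.mul_sum_smul {k B : Type*} [CommSemiring k]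
    [Semiring B] [Algebra k B] {ι : Type*} [Fintype ι] {e : ι → B}
    (he : CompleteOrthogonalIdempotents e) (c : ι → k) (i : ι) :
    e i * ∑ j, c j • e j = c i • e i := by
  classical
  rw [Finset.mul_sum, Finset.sum_eq_single i]
  · rw [mul_smul_comm, (he.idem i).eq]
  · intro j _ hj
    rw [mul_smul_comm, he.ortho hj.symm, smul_zero]
  · simp

/-! ### Unimodular eigenvalues of endomorphisms, via characters -/

section Character

/-- The geometric sums of `z ^ k` stay bounded, so the averages of `z ^ k * a - 1` tend to `-1`; the
terms cannot all have modulus at most `r < 1`. -/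
theorem exists_nat_lt_norm_pow_mul_sub_one {z a : ℂ} {r : ℝ} (hr : r < 1) (hz : ‖z‖ = 1)
    (hz1 : z ≠ 1) : ∃ k : ℕ, r < ‖z ^ k * a - 1‖ := by
  by_contra! h
  have hz1' : 0 < ‖z - 1‖ := norm_pos_iff.mpr (sub_ne_zero.mpr hz1)
  obtain ⟨N, hN⟩ := exists_nat_gt (2 * ‖a‖ / ‖z - 1‖ / (1 - r))
  have h1r : 0 < 1 - r := by linarith
  have h1 : ‖∑ k ∈ Finset.range N, (z ^ k * a - 1)‖ ≤ N * r := by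
    refine (norm_sum_le_of_le _ fun k _ => h k).trans ?_
    simp
  have h2 : ∑ k ∈ Finset.range N, (z ^ k * a - 1) = (z ^ N - 1) / (z - 1) * a - N := by
    rw [Finset.sum_sub_distrib, ← Finset.sum_mul, geom_sum_eq hz1]
    simp
  have h3 : ‖(z ^ N - 1) / (z - 1) * a‖ ≤ 2 * ‖a‖ / ‖z - 1‖ := by
    rw [norm_mul, norm_div, div_mul_eq_mul_div]
    gcongr
    refine (norm_sub_le _ _).trans ?_
    rw [norm_pow, hz, one_pow, norm_one]
    norm_num
  have h4 : (N : ℝ) ≤ ‖(z ^ N - 1) / (z - 1) * a‖ + ‖(z ^ N - 1) / (z - 1) * a - N‖ := by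
    have := norm_sub_le ((z ^ N - 1) / (z - 1) * a) ((z ^ N - 1) / (z - 1) * a - N)
    simpa using this
  rw [h2] at h1
  rw [div_lt_iff₀ h1r] at hN
  linarith

/-- Dirichlet approximation of the argument divided by `2π`; the bound `Q` does not depend on `z`.
-/
theorem exists_nat_norm_pow_sub_one_lt {ε : ℝ} (hε : 0 < ε) :
    ∃ Q : ℕ, ∀ z : ℂ, ‖z‖ = 1 → ∃ q : ℕ, 0 < q ∧ q ≤ Q ∧ ‖z ^ q - 1‖ < ε := by
  obtain ⟨Q, hQ⟩ := exists_nat_gt (2 * Real.pi / ε)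
  have hQ0 : 0 < Q := by
    have : (0 : ℝ) < Q := lt_trans (by positivity) hQ
    exact_mod_cast this
  refine ⟨Q, fun z hz => ?_⟩
  obtain ⟨θ, hθ⟩ := (Complex.norm_eq_one_iff z).mp hz
  obtain ⟨j, k, hk0, hkQ, hjk⟩ := Real.exists_int_int_abs_mul_sub_le (θ / (2 * Real.pi)) hQ0
  lift k to ℕ using hk0.le
  refine ⟨k, by exact_mod_cast hk0, by exact_mod_cast hkQ, ?_⟩
  set t : ℝ := 2 * Real.pi * (k * (θ / (2 * Real.pi)) - j) with ht
  have h1 : z ^ k = Complex.exp (Complex.I * t) := by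
    rw [← hθ, ← Complex.exp_nat_mul, Complex.exp_eq_exp_iff_exists_int]
    refine ⟨j, ?_⟩
    rw [ht]
    have : (Real.pi : ℂ) ≠ 0 := by exact_mod_cast Real.pi_ne_zero
    push_cast
    field_simp
    ring
  rw [h1]
  refine (Real.norm_exp_I_mul_ofReal_sub_one_le).trans_lt ?_
  rw [Real.norm_eq_abs, ht, abs_mul, abs_of_pos Real.two_pi_pos]
  rw [div_lt_iff₀ hε] at hQ
  have hQ1 : (0 : ℝ) < Q + 1 := by positivity
  calc 2 * Real.pi * |↑k * (θ / (2 * Real.pi)) - ↑j| ≤ 2 * Real.pi * (1 / (Q + 1)) := by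
        gcongr
        exact_mod_cast hjk
    _ < ε := by
        rw [mul_one_div, div_lt_iff₀ hQ1]
        nlinarith

variable {B : Type*} [NormedCommRing B] [NormedAlgebra ℂ B]

theorem ContinuousAlgHom.toContinuousLinearMap_pow (T : B →A[ℂ] B) (n : ℕ) :
    (T ^ n).toContinuousLinearMap = T.toContinuousLinearMap ^ n := by
  ext x
  simp [ContinuousAlgHom.coe_pow]

theorem ContinuousAlgHom.pow_apply_eq_smul {T : B →A[ℂ] B} {x : B} {z : ℂ} (hx : T x = z • x)
    (k : ℕ) : (T ^ k) x = z ^ k • x := by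
  induction k with
  | zero => simp
  | succ k ih => rw [pow_succ, ContinuousAlgHom.mul_apply, hx, map_smul, ih, smul_smul, pow_succ']

/-- The algebra of fixed points of an endomorphism. -/
def ContinuousAlgHom.fixedSubalgebra (T : B →A[ℂ] B) : Subalgebra ℂ B :=
  AlgHom.equalizer (T : B →ₐ[ℂ] B) (AlgHom.id ℂ B)

theorem ContinuousAlgHom.toSubmodule_fixedSubalgebra (T : B →A[ℂ] B) :
    Subalgebra.toSubmodule T.fixedSubalgebra
      = Module.End.eigenspace (T.toContinuousLinearMap : B →ₗ[ℂ] B) 1 := by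
  ext x
  rw [Module.End.mem_eigenspace_iff, one_smul]
  exact Iff.rfl

theorem IsQuasicompact.finiteDimensional_fixedSubalgebra {T : B →A[ℂ] B}
    (hT : IsQuasicompact T.toContinuousLinearMap) : FiniteDimensional ℂ T.fixedSubalgebra := by
  have h := hT.hasLeftInverseModCompact (z := 1) (by simp)
  refine h.finiteDimensional_ker (F := Subalgebra.toSubmodule T.fixedSubalgebra) fun x => ?_
  rw [map_one, sub_apply, sub_eq_zero, one_apply_eq_self, eq_comm (a := x)]
  exact Iff.rfl

/-- Cutting by `e` replaces a fixed vector by a scalar multiple of a fixed idempotent, on which some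
character takes the value 1. -/
theorem IsQuasicompact.exists_idempotent_mul_eq_smul [IsReduced B] {T : B →A[ℂ] B}
    (hT : IsQuasicompact T.toContinuousLinearMap) {g : B} (hg : T g = g) (hg0 : g ≠ 0) :
    ∃ (e : B) (c : ℂ), IsIdempotentElem e ∧ e ≠ 0 ∧ T e = e ∧ c ≠ 0 ∧ e * g = c • e := by
  have := hT.finiteDimensional_fixedSubalgebra
  obtain ⟨m, e, he, he0, heF, hspan, -⟩ := T.fixedSubalgebra.exists_orthogonalIdempotents
  obtain ⟨c, hc⟩ := hspan g hg
  have : ∃ i, c i ≠ 0 := by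
    by_contra! h
    exact hg0 (by simp [hc, h])
  obtain ⟨i, hi⟩ := this
  refine ⟨e i, c i, he.idem i, he0 i, heF i, hi, ?_⟩
  rw [hc, he.mul_sum_smul]

/-- Each `x ^ k` is an eigenvector for `z ^ k`, and eigenvalues are bounded by the norm of `T`. -/
theorem norm_le_one_of_eigenvector [IsReduced B] {T : B →A[ℂ] B} {z : ℂ} {x : B} (hx0 : x ≠ 0)
    (hx : T x = z • x) : ‖z‖ ≤ 1 := by
  by_contra! h
  have hb : ∀ k : ℕ, ‖z‖ ^ k ≤ ‖T.toContinuousLinearMap‖ := by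
    intro k
    have h0 : 0 < ‖x ^ k‖ := by
      rcases eq_or_ne k 0 with rfl | hk
      · rw [pow_zero]
        have : Nontrivial B := nontrivial_of_ne x 0 hx0
        exact norm_pos_iff.mpr one_ne_zero
      · exact norm_pos_iff.mpr (pow_ne_zero_iff hk |>.mpr hx0)
    have h1 := T.toContinuousLinearMap.le_opNorm (x ^ k)
    rw [ContinuousAlgHom.coe_toContinuousLinearMap, map_pow, hx, smul_pow, norm_smul, norm_pow] at h1
    exact le_of_mul_le_mul_right h1 h0
  obtain ⟨k, hk⟩ := pow_unbounded_of_one_lt ‖T.toContinuousLinearMap‖ h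
  exact absurd (hb k) (not_le.mpr hk)

variable [CompleteSpace B]

theorem IsIdempotentElem.exists_algHom_apply_eq_one {e : B} (he : IsIdempotentElem e)
    (he0 : e ≠ 0) : ∃ χ : B →ₐ[ℂ] ℂ, χ e = 1 := by
  have hu : ¬ IsUnit (1 - e) := fun hu => he0 (by
    have : e * (1 - e) = 0 := by rw [mul_sub, mul_one, he.eq, sub_self]
    exact (hu.mul_left_eq_zero).mp this)
  obtain ⟨f, hf⟩ := WeakDual.CharacterSpace.exists_apply_eq_zero hu
  refine ⟨WeakDual.CharacterSpace.equivAlgHom f, ?_⟩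
  rw [WeakDual.CharacterSpace.equivAlgHom_coe]
  rw [map_sub, map_one, sub_eq_zero] at hf
  exact hf.symm

/-- The bound is uniform in `k` because `χ ∘ T ^ k` is again a character. -/
theorem norm_algHom_pow_apply_le (χ : B →ₐ[ℂ] ℂ) (T : B →A[ℂ] B) (k : ℕ) (x : B) :
    ‖χ ((T ^ k) x)‖ ≤ ‖x‖ * ‖(1 : B)‖ :=
  AlgHom.norm_apply_le_self_mul_norm_one (χ.comp ((T ^ k : B →A[ℂ] B) : B →ₐ[ℂ] B)) x

/-- The eigenvalue `1` of a quasicompact endomorphism is semisimple. -/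
theorem IsQuasicompact.apply_eq_of_apply_sub_eq [IsReduced B] {T : B →A[ℂ] B}
    (hT : IsQuasicompact T.toContinuousLinearMap) {f : B} (hf : T (T f - f) = T f - f) :
    T f = f := by
  by_contra hne
  set g := T f - f with hg
  obtain ⟨e, c, he, he0, hTe, hc, hec⟩ :=
    hT.exists_idempotent_mul_eq_smul hf (sub_ne_zero.mpr hne)
  obtain ⟨χ, hχ⟩ := he.exists_algHom_apply_eq_one he0
  have hTf : T (e * f) = e * f + c • e := by
    rw [map_mul, hTe, ← hec, ← mul_add, hg, add_sub_cancel]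
  -- A Jordan block makes the orbit grow linearly in the direction `e`, which `χ` detects.
  have hpow : ∀ k : ℕ, (T ^ k) (e * f) = e * f + (k * c) • e := by
    intro k
    induction k with
    | zero => simp
    | succ k ih =>
      rw [pow_succ', ContinuousAlgHom.mul_apply, ih, map_add, map_smul, hTf, hTe, add_assoc,
        ← add_smul]
      push_cast
      ring_nf
  have hc0 : 0 < ‖c‖ := norm_pos_iff.mpr hc
  obtain ⟨k, hk⟩ := exists_nat_gt ((‖e * f‖ * ‖(1 : B)‖ + ‖χ (e * f)‖) / ‖c‖)
  have h1 := norm_algHom_pow_apply_le χ T k (e * f)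
  rw [hpow, map_add, map_smul, hχ, smul_eq_mul, mul_one] at h1
  have h2 := norm_sub_le (χ (e * f) + k * c) (χ (e * f))
  rw [add_sub_cancel_left, norm_mul, Complex.norm_natCast] at h2
  rw [div_lt_iff₀ hc0] at hk
  linarith

theorem IsQuasicompact.exists_unimodular_eigenvalue_isolated [IsReduced B] {T : B →A[ℂ] B}
    (hT : IsQuasicompact T.toContinuousLinearMap) :
    ∃ ε : ℝ, 0 < ε ∧ ∀ z : ℂ, ‖z‖ = 1 → ‖z - 1‖ < ε → ∀ x : B, x ≠ 0 → T x = z • x → z = 1 := by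
  by_contra! hcon
  have h : ∀ n : ℕ, ∃ (z : ℂ) (x : B), ‖z‖ = 1 ∧ ‖z - 1‖ < 1 / ((n : ℝ) + 1) ∧ ‖x‖ = 1 ∧
      T x = z • x ∧ z ≠ 1 := by
    intro n
    obtain ⟨z, hz, hzn, x, hx0, hx, hz1⟩ := hcon (1 / ((n : ℝ) + 1)) (by positivity)
    refine ⟨z, ((‖x‖⁻¹ : ℝ) : ℂ) • x, hz, hzn, ?_, ?_, hz1⟩
    · rw [norm_smul, Complex.norm_real, norm_inv, norm_norm,
        inv_mul_cancel₀ (norm_ne_zero_iff.mpr hx0)]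
    · rw [map_smul, hx, smul_comm]
  choose z x hz hzn hx hTx hz1 using h
  have hU := hT.hasLeftInverseModCompact (z := 1) (by simp)
  obtain ⟨f, φ, -, hφ, hf1, hf0⟩ := hU.exists_tendsto_subseq (x := x) hx (by
    refine squeeze_zero_norm (fun n => ?_) tendsto_one_div_add_atTop_nhds_zero_nat
    rw [map_one, sub_apply, one_apply_eq_self, ContinuousAlgHom.coe_toContinuousLinearMap, hTx,
      ← norm_neg, neg_sub]
    have : z n • x n - x n = (z n - 1) • x n := by rw [sub_smul, one_smul]
    rw [this, norm_smul, hx, mul_one]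
    exact (hzn n).le)
  have hTf : T f = f := by
    rw [map_one, sub_apply, one_apply_eq_self, sub_eq_zero] at hf0
    exact hf0.symm
  obtain ⟨e, c, he, he0, hTe, hc, hec⟩ :=
    hT.exists_idempotent_mul_eq_smul hTf (norm_pos_iff.mp (hf1 ▸ one_pos))
  obtain ⟨χ, hχ⟩ := he.exists_algHom_apply_eq_one he0
  -- Cut and rescaled, the eigenvectors converge to `e`, so `χ ∘ T ^ k` of the difference is small
  -- uniformly in `k`; yet it equals `z ^ k * a - 1`, which is not small for every `k`.
  have hlim : Tendsto (fun n => ‖c⁻¹ • (e * x (φ n)) - e‖ * ‖(1 : B)‖) atTop (𝓝 0) := by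
    have h1 : Tendsto (fun n => c⁻¹ • (e * x (φ n)) - e) atTop (𝓝 (c⁻¹ • (e * f) - e)) :=
      ((hφ.const_mul e).const_smul c⁻¹).sub_const e
    rw [hec, inv_smul_smul₀ hc, sub_self] at h1
    simpa using h1.norm.mul_const ‖(1 : B)‖
  obtain ⟨n, hn⟩ := (hlim.eventually_lt_const (u := 1 / 2) (by norm_num)).exists
  obtain ⟨k, hk⟩ := exists_nat_lt_norm_pow_mul_sub_one (r := 1 / 2)
    (a := χ (c⁻¹ • (e * x (φ n)))) (by norm_num) (hz (φ n)) (hz1 (φ n))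
  have h1 := norm_algHom_pow_apply_le χ T k (c⁻¹ • (e * x (φ n)) - e)
  have h2 : T (c⁻¹ • (e * x (φ n))) = z (φ n) • (c⁻¹ • (e * x (φ n))) := by
    rw [map_smul, map_mul, hTe, hTx, mul_smul_comm, smul_comm]
  have h3 := ContinuousAlgHom.pow_apply_eq_smul h2 k
  have h4 := ContinuousAlgHom.pow_apply_eq_smul (z := 1) (hTe.trans (one_smul ℂ e).symm) k
  rw [one_pow, one_smul] at h4
  rw [map_sub (T ^ k), h3, h4, map_sub, map_smul, hχ, smul_eq_mul] at h1
  linarith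

theorem IsQuasicompact.norm_le_one_of_mem_spectrum [IsReduced B] {T : B →A[ℂ] B}
    (hT : IsQuasicompact T.toContinuousLinearMap) {z : ℂ}
    (hz : z ∈ spectrum ℂ T.toContinuousLinearMap) : ‖z‖ ≤ 1 := by
  by_contra! h
  obtain ⟨w, hw, x, hx0, hx⟩ := exists_eigenvector_forall_norm_le_of_mem_spectrum one_pos
    (fun v hv => hT.hasLeftInverseModCompact hv) hz h.le
  exact absurd (norm_le_one_of_eigenvector hx0 hx) (not_le.mpr (h.trans_le hw))

theorem IsQuasicompact.exists_pow_spectrum_subset [IsReduced B] {T : B →A[ℂ] B}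
    (hT : IsQuasicompact T.toContinuousLinearMap) :
    ∃ n : ℕ, 0 < n ∧
      spectrum ℂ (T ^ n).toContinuousLinearMap ⊆ Metric.ball (0 : ℂ) 1 ∪ {1} := by
  obtain ⟨ε, hε, hiso⟩ := hT.exists_unimodular_eigenvalue_isolated
  obtain ⟨Q, hQ⟩ := exists_nat_norm_pow_sub_one_lt hε
  -- Every unimodular spectral value will be a root of unity of order at most `Q`, and `Q!` is a
  -- multiple of all these orders.
  refine ⟨Q.factorial, Q.factorial_pos, ?_⟩
  rw [ContinuousAlgHom.toContinuousLinearMap_pow, spectrum.map_pow_of_pos _ Q.factorial_pos]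
  rintro _ ⟨z, hz, rfl⟩
  rcases (hT.norm_le_one_of_mem_spectrum hz).lt_or_eq with h | h
  · left
    rw [mem_ball_zero_iff, norm_pow]
    exact pow_lt_one₀ (norm_nonneg _) h Q.factorial_pos.ne'
  · right
    obtain ⟨x, hx0, hx⟩ := exists_eigenvector_of_forall_norm_le
      (norm_pos_iff.mp (h ▸ one_pos)) hz
      (fun w hw => h ▸ hT.norm_le_one_of_mem_spectrum hw) (hT.hasLeftInverseModCompact h.ge)
    obtain ⟨q, hq0, hqQ, hq⟩ := hQ z h
    have hzq : z ^ q = 1 := hiso (z ^ q) (by rw [norm_pow, h, one_pow]) hq (x ^ q)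
      (pow_ne_zero_iff hq0.ne' |>.mpr hx0) (by
        rw [map_pow, ← smul_pow]; exact congrArg (· ^ q) hx)
    obtain ⟨d, hd⟩ := Nat.dvd_factorial hq0 hqQ
    simp only [Set.mem_singleton_iff]
    rw [hd, pow_mul, hzq, one_pow]

/-- The powers of a quasicompact endomorphism with no unimodular spectrum besides `1` converge
to an endomorphism whose range is the fixed subalgebra. -/
theorem IsQuasicompact.exists_tendsto_pow_algHom [IsReduced B] {T : B →A[ℂ] B}
    (hT : IsQuasicompact T.toContinuousLinearMap)
    (hσ : spectrum ℂ T.toContinuousLinearMap ⊆ Metric.ball (0 : ℂ) 1 ∪ {1}) :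
    ∃ P : B →A[ℂ] B,
      Tendsto (fun k : ℕ => (T ^ k).toContinuousLinearMap) atTop (𝓝 P.toContinuousLinearMap) ∧
      (∀ x, T (P x) = P x) ∧ (∀ x, T x = x → P x = x) := by
  obtain ⟨P, hP⟩ := hT.exists_tendsto_pow hσ (fun x hx => hT.apply_eq_of_apply_sub_eq hx)
  have hPx : ∀ x, Tendsto (fun k : ℕ => (T ^ k) x) atTop (𝓝 (P x)) := by
    intro x
    have h := ((ContinuousLinearMap.apply ℂ B x).continuous.tendsto P).comp hP
    refine h.congr fun k => ?_
    rw [← ContinuousAlgHom.coe_toContinuousLinearMap, ContinuousAlgHom.toContinuousLinearMap_pow]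
    rfl
  let P' : B →A[ℂ] B :=
    { AlgHom.ofLinearMap (P : B →ₗ[ℂ] B)
        (tendsto_nhds_unique (hPx 1) (by simp))
        (fun x y => tendsto_nhds_unique (hPx (x * y)) (
          ((hPx x).mul (hPx y)).congr fun k => (map_mul (T ^ k) x y).symm)) with
      cont := P.continuous }
  have hP' : ∀ x, P' x = P x := fun x => rfl
  refine ⟨P', ?_, fun x => ?_, fun x hx => ?_⟩
  · have : P'.toContinuousLinearMap = P := rfl
    rw [this]
    exact hP.congr fun k => (T.toContinuousLinearMap_pow k).symm
  · rw [hP']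
    refine tendsto_nhds_unique ((T.continuous.tendsto _).comp (hPx x)) ?_
    refine ((hPx x).comp (tendsto_add_atTop_nat 1)).congr fun k => ?_
    simp [pow_succ']
  · rw [hP']
    refine tendsto_nhds_unique (hPx x) (tendsto_const_nhds.congr fun k => ?_)
    have := ContinuousAlgHom.pow_apply_eq_smul (z := 1) (hx.trans (one_smul ℂ x).symm) k
    rw [this, one_pow, one_smul]

end Character

/-! ### Restriction of endomorphisms to corners -/

namespace Corner

variable {B : Type*} [NormedCommRing B] [NormedAlgebra ℂ B] {e : B} {he : IsIdempotentElem e}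

/-- The inclusion of `eB` in `B` as a bounded operator. -/
noncomputable def incl (e : B) (he : IsIdempotentElem e) : Corner e he →L[ℂ] B :=
  (cornerSubspace e).subtypeL

theorem val_mk (b : B) : (mk e he b).val = e * b := rfl

theorem mk_val (x : Corner e he) : mk e he x.val = x :=
  val_injective (idem_mul_val x)

/-- Multiplication by `e` as a bounded operator from `B` onto `eB`. -/
noncomputable def proj (e : B) (he : IsIdempotentElem e) : B →L[ℂ] Corner e he :=
  (ContinuousLinearMap.mul ℂ B e).codRestrict (cornerSubspace e) (mul_mem_cornerSubspace e)

/-- The compression of a bounded operator on `B` to `eB`. -/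
noncomputable def compress (e : B) (he : IsIdempotentElem e) (X : B →L[ℂ] B) :
    Corner e he →L[ℂ] Corner e he :=
  (proj e he).comp (X.comp (incl e he))

theorem val_compress (X : B →L[ℂ] B) (x : Corner e he) :
    (compress e he X x).val = e * X x.val := rfl

theorem continuous_compress : Continuous (compress e he) :=
  continuous_const.clm_comp (continuous_id.clm_comp continuous_const)

theorem isCompactOperator_compress {X : B →L[ℂ] B} (hX : IsCompactOperator X) :
    IsCompactOperator (compress e he X) :=
  (hX.comp_clm (incl e he)).clm_comp (proj e he)

theorem compress_one : compress e he 1 = 1 := by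
  ext x
  exact mk_val x

theorem compress_sub (X Y : B →L[ℂ] B) :
    compress e he (X - Y) = compress e he X - compress e he Y := by
  ext x
  refine val_injective ?_
  exact mul_sub e (X x.val) (Y x.val)

/-- The restriction to `eB` of an endomorphism fixing `e`. -/
noncomputable def restrict (he : IsIdempotentElem e) (T : B →A[ℂ] B) (hT : T e = e) :
    Corner e he →A[ℂ] Corner e he where
  toAlgHom := AlgHom.ofLinearMap (compress e he T.toContinuousLinearMap :
      Corner e he →ₗ[ℂ] Corner e he)
    (val_injective (by
      rw [ContinuousLinearMap.coe_coe, val_compress, val_one]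
      exact (congrArg (e * ·) hT).trans he.eq))
    (fun x y => val_injective (by
      rw [ContinuousLinearMap.coe_coe, val_compress, val_mul, val_mul, val_compress, val_compress,
        ContinuousAlgHom.coe_toContinuousLinearMap, map_mul, mul_mul_mul_comm, he.eq]))
  cont := (compress e he T.toContinuousLinearMap).continuous

variable {T : B →A[ℂ] B} {hT : T e = e}

theorem val_restrict (x : Corner e he) : (restrict he T hT x).val = T x.val := by
  have h : (restrict he T hT x).val = e * T x.val := rfl
  rw [h]
  conv_rhs => rw [← idem_mul_val x, map_mul, hT]

theorem val_restrict_pow (k : ℕ) (x : Corner e he) :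
    ((restrict he T hT ^ k) x).val = (T ^ k) x.val := by
  induction k with
  | zero => rfl
  | succ k ih =>
    rw [pow_succ', pow_succ', ContinuousAlgHom.mul_apply, ContinuousAlgHom.mul_apply,
      val_restrict, ih]

theorem restrict_mk (b : B) : restrict he T hT (mk e he b) = mk e he (T b) :=
  val_injective (by rw [val_restrict, val_mk, val_mk, map_mul, hT])

/-- Compression is not multiplicative in general; it is here because `z - T` preserves `eB`. On the
other side, `z - T` commutes with multiplication by `e`. Inverses, exact or modulo compacts,
therefore compress to inverses. -/
theorem compress_mul_algebraMap_sub (V : B →L[ℂ] B) (z : ℂ) :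
    compress e he V * (algebraMap ℂ _ z - (restrict he T hT).toContinuousLinearMap)
      = compress e he (V * (algebraMap ℂ _ z - T.toContinuousLinearMap)) := by
  ext x
  refine val_injective ?_
  have h : ((algebraMap ℂ (Corner e he →L[ℂ] Corner e he) z
      - (restrict he T hT).toContinuousLinearMap) x).val = z • x.val - T x.val := by
    rw [← val_restrict (hT := hT)]
    rfl
  rw [mul_apply_eq_comp, val_compress, val_compress, h]
  rfl

theorem algebraMap_sub_mul_compress (V : B →L[ℂ] B) (z : ℂ) :
    (algebraMap ℂ _ z - (restrict he T hT).toContinuousLinearMap) * compress e he V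
      = compress e he ((algebraMap ℂ _ z - T.toContinuousLinearMap) * V) := by
  ext x
  refine val_injective ?_
  have h : ∀ y : Corner e he, ((algebraMap ℂ (Corner e he →L[ℂ] Corner e he) z
      - (restrict he T hT).toContinuousLinearMap) y).val = z • y.val - T y.val := by
    intro y
    rw [← val_restrict (hT := hT)]
    rfl
  have h2 : ((algebraMap ℂ (B →L[ℂ] B) z - T.toContinuousLinearMap) * V) x.val
      = z • V x.val - T (V x.val) := rfl
  rw [mul_apply_eq_comp, h, val_compress, val_compress, h2, map_mul, hT, mul_sub, mul_smul_comm]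

theorem spectrum_restrict_subset :
    spectrum ℂ (restrict he T hT).toContinuousLinearMap ⊆ spectrum ℂ T.toContinuousLinearMap := by
  intro z hz
  contrapose! hz
  rw [spectrum.notMem_iff] at hz ⊢
  obtain ⟨V, hV1, hV2⟩ := isUnit_iff_exists.mp hz
  refine isUnit_iff_exists.mpr ⟨compress e he V, ?_, ?_⟩
  · rw [algebraMap_sub_mul_compress, hV1, compress_one]
  · rw [compress_mul_algebraMap_sub, hV2, compress_one]

theorem isQuasicompact_restrict (h : IsQuasicompact T.toContinuousLinearMap) :
    IsQuasicompact (restrict he T hT).toContinuousLinearMap := by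
  refine lt_of_le_of_lt ?_ h
  refine iSup₂_le fun z hz => le_iSup₂ (α := ENNReal) z ?_
  contrapose! hz
  rw [spectrum.notMem_iff] at hz ⊢
  obtain ⟨v, hV1, hV2⟩ := isUnit_iff_exists.mp hz
  obtain ⟨V, rfl⟩ := Ideal.Quotient.mk_surjective v
  have key : ∀ W : B →L[ℂ] B, Ideal.Quotient.mk (compactIdeal B) W = 1 →
      Ideal.Quotient.mk (compactIdeal (Corner e he)) (compress e he W) = 1 := by
    intro W hW
    rw [← map_one (Ideal.Quotient.mk _), Ideal.Quotient.mk_eq_mk_iff_sub_mem] at hW ⊢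
    rw [← compress_one, ← compress_sub]
    exact isCompactOperator_compress hW
  refine isUnit_iff_exists.mpr ⟨Ideal.Quotient.mk _ (compress e he V), ?_, ?_⟩
  · have := key _ hV1
    rwa [← algebraMap_sub_mul_compress (hT := hT)] at this
  · have := key _ hV2
    rwa [← compress_mul_algebraMap_sub (hT := hT)] at this

instance [IsReduced B] : IsReduced (Corner e he) := by
  refine (isReduced_iff_pow_one_lt 2 one_lt_two).mpr fun x hx => val_injective ?_
  have h : x.val * x.val = 0 := by
    rw [← val_mul, ← pow_two, hx, val_zero]
  exact IsReduced.eq_zero _ ⟨2, by rw [pow_two, h]⟩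

instance [CompleteSpace B] : CompleteSpace (Corner e he) := by
  have hcl : IsClosed (cornerSubspace e : Set B) := by
    have : (cornerSubspace e : Set B) = {x | e * x = x} := by
      ext x
      exact ⟨fun hx => idem_mul_of_mem he hx, fun hx => ⟨x, hx⟩⟩
    rw [this]
    exact isClosed_eq (continuous_const_mul e) continuous_id
  exact hcl.completeSpace_coe

theorem one_ne_zero_of_ne_zero (he0 : e ≠ 0) : (1 : Corner e he) ≠ 0 := fun h =>
  he0 (by rw [← val_one (he := he), h, val_zero])

end Corner

/-! ### Equivalent norms, algebraic multiplicity and the direct sum -/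

/-- The operator norm of multiplications: an equivalent algebra norm for which `‖1‖ = 1`. -/
theorem exists_equivalent_algebraNorm (A : Type*) [NormedCommRing A] [NormedAlgebra ℂ A]
    [Nontrivial A] : ∃ N : AlgebraNorm ℂ A, N 1 = 1 ∧
      ∃ c C : ℝ, 0 < c ∧ 0 < C ∧ ∀ x, c * ‖x‖ ≤ N x ∧ N x ≤ C * ‖x‖ := by
  let L := ContinuousLinearMap.mul ℂ A
  have hlow : ∀ x, ‖x‖ ≤ ‖L x‖ * ‖(1 : A)‖ := fun x => by
    simpa [L] using (L x).le_opNorm 1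
  have h1 : 0 < ‖(1 : A)‖ := norm_pos_iff.mpr one_ne_zero
  let N : AlgebraNorm ℂ A :=
    { toFun := fun x => ‖L x‖
      map_zero' := by simp
      add_le' := fun x y => by rw [map_add]; exact norm_add_le _ _
      neg' := fun x => by rw [map_neg, norm_neg]
      smul' := fun c x => by rw [map_smul, norm_smul]
      mul_le' := fun x y => by
        have : L (x * y) = L x * L y := by
          ext z
          exact mul_assoc x y z
        rw [this]
        exact norm_mul_le _ _
      eq_zero_of_map_eq_zero' := fun x hx => by
        have := hlow x
        rw [hx, zero_mul] at this
        exact norm_le_zero_iff.mp this }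
  refine ⟨N, ?_, ‖(1 : A)‖⁻¹, 1, inv_pos.mpr h1, one_pos, fun x => ⟨?_, ?_⟩⟩
  · have : L 1 = 1 := by
      ext z
      exact one_mul z
    change ‖L 1‖ = 1
    rw [this, norm_one]
  · rw [inv_mul_le_iff₀ h1, mul_comm]
    exact hlow x
  · rw [one_mul]
    exact ContinuousLinearMap.opNorm_mul_apply_le ℂ A x

/-- Excluding Jordan chains of length two excludes all longer ones, by induction on the exponent. -/
theorem Module.End.maxGenEigenspace_one_eq_eigenspace {R M : Type*} [CommRing R] [AddCommGroup M]
    [Module R M] {f : Module.End R M} (hf : ∀ x, f (f x - x) = f x - x → f x = x) :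
    Module.End.maxGenEigenspace f 1 = Module.End.eigenspace f 1 := by
  refine le_antisymm (fun x hx => ?_) (fun x hx => ?_)
  · obtain ⟨k, hk⟩ := (Module.End.mem_maxGenEigenspace f 1 x).mp hx
    rw [Module.End.mem_eigenspace_iff, one_smul]
    rw [one_smul] at hk
    clear hx
    induction k generalizing x with
    | zero =>
      have : x = 0 := by simpa using hk
      rw [this, map_zero]
    | succ k ih => exact hf x (ih (f x - x) (by simpa [pow_succ] using hk))
  · refine (Module.End.mem_maxGenEigenspace f 1 x).mpr ⟨1, ?_⟩
    rw [Module.End.mem_eigenspace_iff, one_smul] at hx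
    simp [hx]

theorem CompleteOrthogonalIdempotents.isInternal_cornerSubspace {B : Type*} [NormedCommRing B]
    [NormedAlgebra ℂ B] {m : ℕ} {e : Fin m → B} (he : CompleteOrthogonalIdempotents e) :
    DirectSum.IsInternal (fun i => cornerSubspace (e i)) := by
  rw [DirectSum.isInternal_submodule_iff_iSupIndep_and_iSup_eq_top]
  refine ⟨fun i => ?_, ?_⟩
  · rw [Submodule.disjoint_def]
    intro x hx hx'
    have hle : ⨆ j, ⨆ (_ : j ≠ i), cornerSubspace (e j) ≤
        LinearMap.ker (LinearMap.mulLeft ℂ (e i)) := by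
      refine iSup₂_le fun j hj => ?_
      rintro _ ⟨b, rfl⟩
      rw [LinearMap.mem_ker, LinearMap.mulLeft_apply, LinearMap.mulLeft_apply, ← mul_assoc,
        he.ortho hj.symm, zero_mul]
    have h := hle hx'
    rw [LinearMap.mem_ker, LinearMap.mulLeft_apply] at h
    rw [← idem_mul_of_mem (he.idem i) hx, h]
  · refine eq_top_iff.mpr fun x _ => ?_
    have h : x = ∑ i, e i * x := by rw [← Finset.sum_mul, he.complete, one_mul]
    rw [h]
    exact Submodule.sum_mem _ fun i _ =>
      Submodule.mem_iSup_of_mem i (mul_mem_cornerSubspace (e i) x)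

theorem CompleteOrthogonalIdempotents.linearIndependent {k B : Type*} [Field k] [Ring B]
    [Algebra k B] {ι : Type*} [Fintype ι] {e : ι → B} (he : CompleteOrthogonalIdempotents e)
    (he0 : ∀ i, e i ≠ 0) : LinearIndependent k e := by
  rw [Fintype.linearIndependent_iff]
  intro c hc i
  have := he.mul_sum_smul c i
  rw [hc, mul_zero] at this
  exact (smul_eq_zero.mp this.symm).resolve_right (he0 i)

/-! ### Assembly of the main theorem -/

theorem theorem3p2 {B : Type*} [NormedCommRing B] [NormedAlgebra ℂ B] [CompleteSpace B]
    [Nontrivial B] (hB : IsSemiprimeAlg B)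
    (T : B →A[ℂ] B) (hT : IsQuasicompact T.toContinuousLinearMap) :
    (∃ n : ℕ, 0 < n ∧
      spectrum ℂ (T ^ n).toContinuousLinearMap ⊆ Metric.ball (0 : ℂ) 1 ∪ {1}) ∧
    ∀ n : ℕ, 0 < n →
      spectrum ℂ (T ^ n).toContinuousLinearMap ⊆ Metric.ball (0 : ℂ) 1 ∪ {1} →
      IsQuasicompact (T ^ n).toContinuousLinearMap ∧
      ∃ (m : ℕ) (e : Fin m → B) (he : OrthogonalIdempotents e),
        -- the eigenspace of `T ^ n` for the eigenvalue `1`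
        (0 < m ∧
          (∃ A : Subalgebra ℂ B,
            Subalgebra.toSubmodule A
              = Module.End.eigenspace ((T ^ n).toContinuousLinearMap : B →ₗ[ℂ] B) 1 ∧
            FiniteDimensional ℂ A ∧ Nonempty (A ≃ₐ[ℂ] (Fin m → ℂ))) ∧
          Submodule.span ℂ (Set.range e)
            = Module.End.eigenspace ((T ^ n).toContinuousLinearMap : B →ₗ[ℂ] B) 1) ∧
        -- the summands `e i * B`
        ((∀ i, CompleteSpace (Corner (e i) (he.idem i)) ∧
            IsSemiprimeAlg (Corner (e i) (he.idem i)) ∧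
            ∃ N : AlgebraNorm ℂ (Corner (e i) (he.idem i)), N 1 = 1 ∧
              ∃ c C : ℝ, 0 < c ∧ 0 < C ∧ ∀ x, c * ‖x‖ ≤ N x ∧ N x ≤ C * ‖x‖) ∧
          DirectSum.IsInternal (fun i => cornerSubspace (e i))) ∧
        ∃ (R S : ∀ i, Corner (e i) (he.idem i) →A[ℂ] Corner (e i) (he.idem i)),
          -- `R i` is the restriction of `T ^ n` to `e i * B`, and `S i` the limit of its powers
          (∀ i, (∀ x, (R i x).val = (T ^ n) x.val) ∧
            IsQuasicompact (R i).toContinuousLinearMap ∧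
            spectrum ℂ (R i).toContinuousLinearMap ⊆ Metric.ball (0 : ℂ) 1 ∪ {1} ∧
            Module.End.HasEigenvalue
              ((R i).toContinuousLinearMap : Module.End ℂ (Corner (e i) (he.idem i))) 1 ∧
            Module.finrank ℂ (Module.End.eigenspace
              ((R i).toContinuousLinearMap : Module.End ℂ (Corner (e i) (he.idem i))) 1) = 1 ∧
            Module.finrank ℂ (Module.End.maxGenEigenspace
              ((R i).toContinuousLinearMap : Module.End ℂ (Corner (e i) (he.idem i))) 1) = 1 ∧
            LinearMap.rank
              ((S i).toContinuousLinearMap : Module.End ℂ (Corner (e i) (he.idem i))) = 1 ∧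
            Tendsto (fun k : ℕ => (R i ^ k).toContinuousLinearMap) atTop
              (𝓝 (S i).toContinuousLinearMap)) ∧
          -- the limit of the operators `T ^ (k * n)` on `B`
          ∃ S₀ : B →A[ℂ] B,
            (∀ b, S₀ b = ∑ i, (S i (Corner.mk (e i) (he.idem i) b)).val) ∧
            LinearMap.rank (S₀.toContinuousLinearMap : B →ₗ[ℂ] B) = m ∧
            Tendsto (fun k : ℕ => (T ^ (k * n)).toContinuousLinearMap) atTop
              (𝓝 S₀.toContinuousLinearMap) := by
  have := hB.isReduced
  refine ⟨hT.exists_pow_spectrum_subset, fun n hn hσ => ?_⟩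
  have hTn : IsQuasicompact (T ^ n).toContinuousLinearMap := by
    rw [ContinuousAlgHom.toContinuousLinearMap_pow]
    exact hT.pow hn
  refine ⟨hTn, ?_⟩
  set U := T ^ n with hU
  have hfin := hTn.finiteDimensional_fixedSubalgebra
  obtain ⟨m, e, he, he0, heF, hspan, hiso⟩ := U.fixedSubalgebra.exists_orthogonalIdempotents
  obtain ⟨P, hP, hUP, hPfix⟩ := hTn.exists_tendsto_pow_algHom hσ
  have hm : 0 < m := by
    rcases Nat.eq_zero_or_pos m with rfl | h
    · exact absurd he.complete (by simp)
    · exact h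
  have hspan' : Submodule.span ℂ (Set.range e) = Subalgebra.toSubmodule U.fixedSubalgebra := by
    refine le_antisymm (Submodule.span_le.mpr ?_) fun x hx => ?_
    · rintro _ ⟨i, rfl⟩
      exact heF i
    · obtain ⟨c, rfl⟩ := hspan x hx
      exact Submodule.sum_mem _ fun i _ =>
        Submodule.smul_mem _ _ (Submodule.subset_span (Set.mem_range_self i))
  have hnt : ∀ i, (1 : Corner (e i) (he.idem i)) ≠ 0 := fun i =>
    Corner.one_ne_zero_of_ne_zero (he0 i)
  have hPe : ∀ i, P (e i) = e i := fun i => hPfix _ (heF i)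
  -- A fixed point is a combination of the `e j`, and multiplication by `e i` keeps only the term in
  -- `e i`; so the fixed space of each corner is a line.
  have hfixed : ∀ i (x : Corner (e i) (he.idem i)), U x.val = x.val →
      x ∈ Submodule.span ℂ {(1 : Corner (e i) (he.idem i))} := by
    intro i x hx
    obtain ⟨c, hc⟩ := hspan _ hx
    refine Submodule.mem_span_singleton.mpr ⟨c i, Corner.val_injective ?_⟩
    rw [Corner.val_smul, Corner.val_one, ← Corner.idem_mul_val x, hc, he.mul_sum_smul]
  refine ⟨m, e, he.toOrthogonalIdempotents,
    ⟨hm, ⟨U.fixedSubalgebra, U.toSubmodule_fixedSubalgebra, hfin, hiso⟩,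
      hspan'.trans U.toSubmodule_fixedSubalgebra⟩,
    ⟨fun i => ⟨inferInstance, isSemiprimeAlg_of_isReduced _, ?_⟩, he.isInternal_cornerSubspace⟩,
    fun i => Corner.restrict (he.idem i) U (heF i),
    fun i => Corner.restrict (he.idem i) P (hPe i), fun i => ?_, P, fun b => ?_, ?_, ?_⟩
  · have : Nontrivial (Corner (e i) (he.idem i)) := nontrivial_of_ne _ _ (hnt i)
    exact exists_equivalent_algebraNorm _
  · have heig : Module.End.eigenspace
        ((Corner.restrict (he.idem i) U (heF i)).toContinuousLinearMap :
          Module.End ℂ (Corner (e i) (he.idem i))) 1 = Submodule.span ℂ {1} := by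
      refine le_antisymm (fun x hx => hfixed i x ?_) ?_
      · rw [Module.End.mem_eigenspace_iff, one_smul] at hx
        rw [← Corner.val_restrict (he := he.idem i) (hT := heF i)]
        exact congrArg Corner.val hx
      · rw [Submodule.span_singleton_le_iff_mem, Module.End.mem_eigenspace_iff, one_smul]
        exact map_one (Corner.restrict (he.idem i) U (heF i))
    have hrank1 : Module.finrank ℂ (Submodule.span ℂ {(1 : Corner (e i) (he.idem i))}) = 1 :=
      finrank_span_singleton (hnt i)
    refine ⟨Corner.val_restrict, Corner.isQuasicompact_restrict hTn,
      Corner.spectrum_restrict_subset.trans hσ, ?_, ?_, ?_, ?_, ?_⟩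
    · rw [Module.End.hasEigenvalue_iff, heig, Ne, Submodule.span_singleton_eq_bot]
      exact hnt i
    · rw [heig, hrank1]
    · rw [Module.End.maxGenEigenspace_one_eq_eigenspace, heig, hrank1]
      intro x hx
      refine Corner.val_injective ?_
      have h1 : U x.val = x.val := by
        refine hTn.apply_eq_of_apply_sub_eq (T := U) ?_
        rw [← Corner.val_restrict (he := he.idem i) (hT := heF i)]
        have h2 := congrArg Corner.val hx
        have h3 := Corner.val_restrict (he := he.idem i) (hT := heF i)
          (Corner.restrict (he.idem i) U (heF i) x - x)
        exact h3.symm.trans h2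
      exact (Corner.val_restrict x).trans h1
    · have hrange : LinearMap.range
          ((Corner.restrict (he.idem i) P (hPe i)).toContinuousLinearMap :
            Module.End ℂ (Corner (e i) (he.idem i))) = Submodule.span ℂ {1} := by
        refine le_antisymm ?_ ?_
        · rintro _ ⟨x, rfl⟩
          refine hfixed i _ ?_
          have h1 : (Corner.restrict (he.idem i) P (hPe i) x).val = P x.val :=
            Corner.val_restrict x
          exact (congrArg U h1).trans ((hUP _).trans h1.symm)
        · rw [Submodule.span_singleton_le_iff_mem]
          exact ⟨1, map_one (Corner.restrict (he.idem i) P (hPe i))⟩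
      rw [LinearMap.rank, hrange, ← Module.finrank_eq_rank, hrank1, Nat.cast_one]
    -- Compression is norm continuous, and `U ^ k` fixes `e i`, so compressing `U ^ k` gives the
    -- `k`-th power of the restriction.
    · refine (Corner.continuous_compress.tendsto _ |>.comp hP).congr fun k => ?_
      ext x
      refine Corner.val_injective ?_
      have h1 := Corner.val_restrict_pow (he := he.idem i) (T := U) (hT := heF i) k x
      refine Eq.trans ?_ h1.symm
      have h2 : (U ^ k) (e i) = e i := by
        rw [ContinuousAlgHom.pow_apply_eq_smul (z := 1) ((heF i).trans (one_smul ℂ _).symm),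
          one_pow, one_smul]
      have h3 : (U ^ k) x.val = e i * (U ^ k) x.val := by
        conv_lhs => rw [← Corner.idem_mul_val x, map_mul, h2]
      exact h3.symm
  · have h : ∀ i, (Corner.restrict (he.idem i) P (hPe i) (Corner.mk (e i) (he.idem i) b)).val
        = e i * P b := fun i => by rw [Corner.restrict_mk, Corner.val_mk]
    simp only [h]
    rw [← Finset.sum_mul, he.complete, one_mul]
  · have hrange : LinearMap.range (P.toContinuousLinearMap : B →ₗ[ℂ] B)
        = Submodule.span ℂ (Set.range e) := by
      rw [hspan']
      refine le_antisymm ?_ fun x hx => ⟨x, hPfix x hx⟩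
      rintro _ ⟨x, rfl⟩
      exact hUP x
    have := FiniteDimensional.span_of_finite ℂ (Set.finite_range e)
    rw [LinearMap.rank, hrange, ← Module.finrank_eq_rank,
      finrank_span_eq_card (he.linearIndependent he0), Fintype.card_fin]
  · refine hP.congr fun k => ?_
    rw [hU, ← pow_mul, mul_comm]
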